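/- Let $d \ge 3$, let $U \subset \mathbb{R}^d$ be a bounded open set, let $\mathbf{H} \in L^d(U,\mathbb{R}^d)$, and let $A = (a_{ij})_{1\le i,j\le d}$ be a (possibly non-symmetric) matrix of measurable functions on $\mathbb{R}^d$ for which there are constants $M > 0$ and $\lambda > 0$ with $$\max_{1\le i,j\le d} |a_{ij}(x)| \le M, \qquad \langle A(x)\xi, \xi\rangle \ge \lambda \|\xi\|^2 \qquad \text{for a.e. } x \in \mathbb{R}^d \text{ and all } \xi \in \mathbb{R}^d.$$ Let $H_0^{1,2}(U)$ be the closure of $C_0^\infty(U)$ in the Sobolev space $H^{1,2}(U)$ of functions in $L^2(U)$ with weak gradient in $L^2(U,\mathbb{R}^d)$, and let $H^{-1,2}(U)$ be the dual space of $H_0^{1,2}(U)$, with duality pairing $\langle\cdot,\cdot\rangle_{H^{-1,2}(U)}$. Then the integral $$\mathcal{B}(f,\varphi) := \int_U \langle A\nabla f + f\,\mathbf{H}, \nabla\varphi\rangle\,dx$$ converges absolutely for all $f, \varphi \in H_0^{1,2}(U)$, and for every $g \in H^{-1,2}(U)$ there exists a unique $u_g \in H_0^{1,2}(U)$ such that $$\mathcal{B}(u_g,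 \varphi) = \langle g, \varphi\rangle_{H^{-1,2}(U)} \qquad \text{for all } \varphi \in H_0^{1,2}(U).$$ -/

import Mathlib

open MeasureTheory
open scoped ContDiff ENNReal

/-- `d`-dimensional Euclidean space. -/
abbrev Euc (d : ℕ) : Type := EuclideanSpace ℝ (Fin d)

/-- Membership in `C₀^∞(U)`: smooth functions with compact support contained in `U`. -/
structure IsTestFunction {d : ℕ} (U : Set (Euc d)) (φ : Euc d → ℝ) : Prop where
  contDiff : ContDiff ℝ ∞ φ
  hasCompactSupport : HasCompactSupport φ
  tsupport_subset : tsupport φ ⊆ U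

/-- The classical partial derivative `∂ᵢ φ (x)`. -/
noncomputable def partialDeriv {d : ℕ} (i : Fin d) (φ : Euc d → ℝ) (x : Euc d) : ℝ :=
  fderiv ℝ φ x (EuclideanSpace.single i (1 : ℝ))

/-- `G` is the weak gradient of `u` on `U`: for each `i`, `G i` is the weak partial derivative
`∂ᵢ u`, i.e. `∫_U u ∂ᵢφ dx = - ∫_U Gᵢ φ dx` for all `φ ∈ C₀^∞(U)`. -/
def IsWeakGradient {d : ℕ} (U : Set (Euc d)) (u : Euc d → ℝ) (G : Euc d → Euc d) : Prop :=
  ∀ φ : Euc d → ℝ, IsTestFunction U φ → ∀ i : Fin d,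
    ∫ x in U, u x * partialDeriv i φ x = - ∫ x in U, G x i * φ x

/-- The Hilbert space `L²(U) × L²(U, ℝᵈ)`, with `‖(u, G)‖² = ‖u‖²_{L²} + ‖G‖²_{L²}`. -/
abbrev L2Pair {d : ℕ} (U : Set (Euc d)) : Type :=
  WithLp 2 (Lp ℝ 2 (volume.restrict U) × Lp (Euc d) 2 (volume.restrict U))

theorem IsTestFunction.integrable_mul {d : ℕ} {U : Set (Euc d)} {φ : Euc d → ℝ}
    (hφ : IsTestFunction U φ) {f : Euc d → ℝ} (hf : MemLp f 2 (volume.restrict U)) :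
    Integrable (fun x => f x * φ x) (volume.restrict U) :=
  hf.integrable_mul (q := 2)
    ((hφ.contDiff.continuous.memLp_of_hasCompactSupport hφ.hasCompactSupport).restrict U)

theorem IsTestFunction.integrable_mul_partialDeriv {d : ℕ} {U : Set (Euc d)} {φ : Euc d → ℝ}
    (hφ : IsTestFunction U φ) (i : Fin d) {f : Euc d → ℝ} (hf : MemLp f 2 (volume.restrict U)) :
    Integrable (fun x => f x * partialDeriv i φ x) (volume.restrict U) := by
  have hc : Continuous (partialDeriv i φ) :=
    (hφ.contDiff.continuous_fderiv (by simp)).clm_apply continuous_const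
  exact hf.integrable_mul (q := 2) ((hc.memLp_of_hasCompactSupport
    (hφ.hasCompactSupport.fderiv_apply ℝ (EuclideanSpace.single i (1 : ℝ)))).restrict U)

theorem memLp_two_coord {d : ℕ} {U : Set (Euc d)} (i : Fin d)
    (G : Lp (Euc d) 2 (volume.restrict U)) :
    MemLp (fun x => G x i) 2 (volume.restrict U) :=
  (EuclideanSpace.proj (𝕜 := ℝ) i).comp_memLp' (Lp.memLp G)

/-- The Sobolev space `H^{1,2}(U)`. A function `u ∈ L²(U)` with weak gradient in `L²(U, ℝᵈ)` is
stored together with this (unique) gradient, so that the induced norm is the Sobolev norm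
`‖u‖² = ‖u‖²_{L²} + ‖∇u‖²_{L²}`. -/
noncomputable def SobolevH1 {d : ℕ} (U : Set (Euc d)) : Submodule ℝ (L2Pair U) where
  carrier := {w | IsWeakGradient U w.fst w.snd}
  zero_mem' := by
    intro φ hφ i
    have h1 : ∫ x in U, ((0 : L2Pair U).fst : Euc d → ℝ) x * partialDeriv i φ x = 0 := by
      apply integral_eq_zero_of_ae
      filter_upwards [Lp.coeFn_zero ℝ 2 (volume.restrict U)] with x hx
      change (0 : Lp ℝ 2 (volume.restrict U)) x * _ = 0
      rw [hx, Pi.zero_apply, zero_mul]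
    have h2 : ∫ x in U, ((0 : L2Pair U).snd : Euc d → Euc d) x i * φ x = 0 := by
      apply integral_eq_zero_of_ae
      filter_upwards [Lp.coeFn_zero (Euc d) 2 (volume.restrict U)] with x hx
      change (0 : Lp (Euc d) 2 (volume.restrict U)) x i * _ = 0
      rw [hx, Pi.zero_apply, PiLp.zero_apply, zero_mul]
    rw [h1, h2, neg_zero]
  add_mem' := by
    intro v w hv hw φ hφ i
    have h1 : ∫ x in U, (v + w).fst x * partialDeriv i φ x
        = ∫ x in U, (v.fst x * partialDeriv i φ x + w.fst x * partialDeriv i φ x) := by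
      apply integral_congr_ae
      filter_upwards [Lp.coeFn_add v.fst w.fst] with x hx
      change (v.fst + w.fst) x * _ = _
      rw [hx, Pi.add_apply, add_mul]
    have h2 : ∫ x in U, (v + w).snd x i * φ x
        = ∫ x in U, (v.snd x i * φ x + w.snd x i * φ x) := by
      apply integral_congr_ae
      filter_upwards [Lp.coeFn_add v.snd w.snd] with x hx
      change (v.snd + w.snd) x i * _ = _
      rw [hx, Pi.add_apply, PiLp.add_apply, add_mul]
    rw [h1, h2, integral_add (hφ.integrable_mul_partialDeriv i (Lp.memLp _))
      (hφ.integrable_mul_partialDeriv i (Lp.memLp _)),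
      integral_add (hφ.integrable_mul (memLp_two_coord i _))
      (hφ.integrable_mul (memLp_two_coord i _)), hv φ hφ i, hw φ hφ i]
    ring
  smul_mem' := by
    intro c v hv φ hφ i
    have h1 : ∫ x in U, (c • v).fst x * partialDeriv i φ x
        = ∫ x in U, c * (v.fst x * partialDeriv i φ x) := by
      apply integral_congr_ae
      filter_upwards [Lp.coeFn_smul c v.fst] with x hx
      simp [hx, mul_assoc]
    have h2 : ∫ x in U, (c • v).snd x i * φ x = ∫ x in U, c * (v.snd x i * φ x) := by
      apply integral_congr_ae
      filter_upwards [Lp.coeFn_smul c v.snd] with x hx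
      simp [hx, mul_assoc]
    rw [h1, h2, integral_const_mul, integral_const_mul, hv φ hφ i]
    ring

/-- The weak gradient is unique: an element of `H^{1,2}(U)` is determined by its function. -/
theorem SobolevH1.eq_of_fun_eq {d : ℕ} {U : Set (Euc d)} (hU : IsOpen U) {v w : SobolevH1 U}
    (h : v.1.fst = w.1.fst) : v = w := by
  have key : ∀ i : Fin d, ∀ᵐ x ∂volume, x ∈ U → v.1.snd x i - w.1.snd x i = 0 := by
    intro i
    have hvi := memLp_two_coord i v.1.snd
    have hwi := memLp_two_coord i w.1.snd
    refine hU.ae_eq_zero_of_integral_contDiff_smul_eq_zero ?_ ?_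
    · have hint : LocallyIntegrable (fun x => v.1.snd x i - w.1.snd x i) (volume.restrict U) :=
        (hvi.sub hwi).locallyIntegrable (by norm_num)
      exact locallyIntegrableOn_of_locallyIntegrable_restrict hint
    · intro φ hφ hc hs
      have ht : IsTestFunction U φ := ⟨hφ, hc, hs⟩
      have e1 := v.2 φ ht i
      have e2 := w.2 φ ht i
      rw [h] at e1
      have e3 : ∫ x in U, (v.1.snd x i * φ x - w.1.snd x i * φ x) = 0 := by
        rw [integral_sub (ht.integrable_mul hvi) (ht.integrable_mul hwi)]
        linarith
      have e4 : ∫ x in U, φ x • (v.1.snd x i - w.1.snd x i) = 0 := by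
        rw [← e3]
        congr 1
        ext x
        simp only [smul_eq_mul]
        ring
      rw [← e4]
      symm
      apply setIntegral_eq_integral_of_forall_compl_eq_zero
      intro x hx
      rw [image_eq_zero_of_notMem_tsupport (fun hx' => hx (hs hx')), zero_smul]
  have hsnd : v.1.snd = w.1.snd := by
    apply Lp.ext
    rw [Filter.EventuallyEq, ae_restrict_iff' hU.measurableSet]
    filter_upwards [ae_all_iff.2 key] with x hx hxU
    ext i
    exact sub_eq_zero.1 (hx i hxU)
  apply Subtype.ext
  apply (WithLp.ofLp_injective 2)
  exact Prod.ext h hsnd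

/-- The subspace `C₀^∞(U)` of `H^{1,2}(U)`. -/
noncomputable def testFunctions {d : ℕ} (U : Set (Euc d)) : Submodule ℝ (SobolevH1 U) where
  carrier := {w | ∃ φ : Euc d → ℝ, IsTestFunction U φ ∧ w.1.fst =ᵐ[volume.restrict U] φ}
  zero_mem' := ⟨fun _ => 0,
    ⟨contDiff_const, HasCompactSupport.zero, by simp [tsupport, Function.support]⟩,
    Lp.coeFn_zero ℝ 2 (volume.restrict U)⟩
  add_mem' := by
    rintro v w ⟨φ, hφ, hv⟩ ⟨ψ, hψ, hw⟩
    refine ⟨φ + ψ, ⟨hφ.contDiff.add hψ.contDiff, hφ.hasCompactSupport.add hψ.hasCompactSupport,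
      (tsupport_add φ ψ).trans (Set.union_subset hφ.tsupport_subset hψ.tsupport_subset)⟩, ?_⟩
    exact (Lp.coeFn_add v.1.fst w.1.fst).trans (hv.add hw)
  smul_mem' := by
    rintro c v ⟨φ, hφ, hv⟩
    refine ⟨c • φ, ⟨contDiff_const.smul hφ.contDiff, hφ.hasCompactSupport.smul_left,
      (closure_mono (Function.support_const_smul_subset c φ)).trans hφ.tsupport_subset⟩, ?_⟩
    exact (Lp.coeFn_smul c v.1.fst).trans (hv.const_smul c)

/-- `H₀^{1,2}(U)`: the closure of `C₀^∞(U)` in `H^{1,2}(U)`. -/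
noncomputable def SobolevH10 {d : ℕ} (U : Set (Euc d)) : Submodule ℝ (SobolevH1 U) :=
  (testFunctions U).topologicalClosure

/-- The function underlying an element of `H₀^{1,2}(U)`. -/
noncomputable def sobolevFun {d : ℕ} {U : Set (Euc d)} (u : SobolevH10 U) :
    Lp ℝ 2 (volume.restrict U) := u.1.1.fst

/-- The weak gradient `∇u` of an element `u` of `H₀^{1,2}(U)`. -/
noncomputable def sobolevGrad {d : ℕ} {U : Set (Euc d)} (u : SobolevH10 U) :
    Lp (Euc d) 2 (volume.restrict U) := u.1.1.snd

/-- `H^{-1,2}(U)`: the (continuous) dual space of `H₀^{1,2}(U)`. -/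
abbrev SobolevHneg1 {d : ℕ} (U : Set (Euc d)) : Type := StrongDual ℝ (SobolevH10 U)

/-- `A` is a matrix of measurable functions on `ℝᵈ` with `max |aᵢⱼ(x)| ≤ M` and
`⟨A(x)ξ, ξ⟩ ≥ lam ‖ξ‖²` for a.e. `x` and all `ξ`. -/
structure IsUniformlyElliptic {d : ℕ} (A : Euc d → Matrix (Fin d) (Fin d) ℝ) (M lam : ℝ) :
    Prop where
  aemeasurable : ∀ i j, AEMeasurable (fun x => A x i j) volume
  bounded : ∀ᵐ x ∂(volume : Measure (Euc d)), ∀ i j, |A x i j| ≤ M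
  elliptic : ∀ᵐ x ∂(volume : Measure (Euc d)), ∀ ξ : Euc d,
    lam * ‖ξ‖ ^ 2 ≤ inner ℝ ((A x).toEuclideanLin ξ) ξ

/-- The integrand `⟨A∇f + f H, ∇g⟩`. -/
noncomputable def formIntegrand {d : ℕ} {U : Set (Euc d)} (A : Euc d → Matrix (Fin d) (Fin d) ℝ)
    (H : Euc d → Euc d) (f g : SobolevH10 U) (x : Euc d) : ℝ :=
  inner ℝ ((A x).toEuclideanLin (sobolevGrad f x) + sobolevFun f x • H x) (sobolevGrad g x)

/-- The bilinear form `B(f, g) = ∫_U ⟨A∇f + f H, ∇g⟩ dx` on `H₀^{1,2}(U)`. -/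
noncomputable def dirichletForm {d : ℕ} {U : Set (Euc d)} (A : Euc d → Matrix (Fin d) (Fin d) ℝ)
    (H : Euc d → Euc d) (f g : SobolevH10 U) : ℝ :=
  ∫ x in U, formIntegrand A H f g x

/-!
The proof solves the equation by the method of continuity, from an a priori estimate that is uniform
along the family of forms with drift `t H`, `t ∈ [0, 1]`; no compactness is used.

The form is represented by bounded operators on Hilbert spaces: multiplication by `A` on
`L²(U, ℝᵈ)`, and `u ↦ u H` from `H₀^{1,2}(U)` to `L²(U, ℝᵈ)`, which is bounded because of the Sobolev
embedding `H₀^{1,2}(U) ⊂ L^{2*}(U)` and Hölder's inequality with `1 / 2* + 1 / d = 1 / 2`. This gives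
absolute convergence of the integral. For `t = 0` the form is coercive by ellipticity and the
Poincaré inequality.

The drift is neither small nor of a sign that preserves coercivity, so the a priori estimate needs an
argument. By density it suffices to consider a test function `u` solving the equation with drift
`t H` and a right-hand side of norm at most `1`.

* Testing with `arctan u` bounds the gradient of `arsinh u` (`norm_grad_arsinh_le`): the drift term is
  harmless there, because `|u| / √(1 + u²) ≤ 1` and `H ∈ L²(U)`. By Poincaré and Chebyshev, the sets
  `{|u| ≥ k}` are small for large `k`, uniformly in `u` (`exists_superlevel_le_of_weakSolution`).
* Consequently `‖u‖₂ ≤ L + η ‖∇u‖₂` with `η` as small as desired (`exists_norm_sobolevFun_le_add`).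
* Splitting `H` into a part that is small in `L^d` and a bounded part gives
  `‖u H‖₂ ≤ ε ‖∇u‖₂ + N ‖u‖₂` (`exists_eLpNorm_sobolevFun_smul_le`). Testing with `u` itself, both
  contributions are absorbed by ellipticity (`exists_apriori_testFunctions`).

Composition of a test function with `arctan` or `arsinh` is again a test function, so no chain rule
for Sobolev functions is required.
-/

open Filter Topology Gradient NNReal

/-! ### Test functions as elements of `H₀^{1,2}(U)` -/

section TestFunctions

variable {d : ℕ} {U : Set (Euc d)} {φ : Euc d → ℝ}

namespace IsTestFunction

theorem differentiable (hφ : IsTestFunction U φ) : Differentiable ℝ φ :=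
  hφ.contDiff.differentiable (by simp)

theorem memLp (hφ : IsTestFunction U φ) : MemLp φ 2 (volume.restrict U) :=
  (hφ.contDiff.continuous.memLp_of_hasCompactSupport hφ.hasCompactSupport).restrict U

theorem memLp_gradient (hφ : IsTestFunction U φ) : MemLp (∇ φ) 2 (volume.restrict U) := by
  have hc : Continuous (∇ φ) :=
    (InnerProductSpace.toDual ℝ (Euc d)).symm.continuous.comp
      (hφ.contDiff.continuous_fderiv (by simp))
  have hs : HasCompactSupport (∇ φ) :=
    (hφ.hasCompactSupport.fderiv ℝ).comp_left (map_zero _)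
  exact (hc.memLp_of_hasCompactSupport hs).restrict U

theorem gradient_apply (x : Euc d) (i : Fin d) : ∇ φ x i = partialDeriv i φ x := by
  rw [partialDeriv, ← inner_gradient_left, EuclideanSpace.inner_single_right]
  simp

theorem isWeakGradient (hφ : IsTestFunction U φ) : IsWeakGradient U φ (∇ φ) := by
  intro ψ hψ i
  have h1 : ∫ x in U, φ x * partialDeriv i ψ x = ∫ x, φ x * partialDeriv i ψ x := by
    apply setIntegral_eq_integral_of_forall_compl_eq_zero
    intro x hx
    rw [image_eq_zero_of_notMem_tsupport (fun h => hx (hφ.tsupport_subset h)), zero_mul]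
  have h2 : ∫ x in U, ∇ φ x i * ψ x = ∫ x, partialDeriv i φ x * ψ x := by
    simp only [gradient_apply]
    apply setIntegral_eq_integral_of_forall_compl_eq_zero
    intro x hx
    rw [image_eq_zero_of_notMem_tsupport (fun h => hx (hψ.tsupport_subset h)), mul_zero]
  have hc : ∀ {η : Euc d → ℝ}, IsTestFunction U η → Continuous (partialDeriv i η) := fun hη =>
    (hη.contDiff.continuous_fderiv (by simp)).clm_apply continuous_const
  rw [h1, h2]
  exact integral_mul_fderiv_eq_neg_fderiv_mul_of_integrable
    (((hc hφ).mul hψ.contDiff.continuous).integrable_of_hasCompactSupport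
      hψ.hasCompactSupport.mul_left)
    ((hφ.contDiff.continuous.mul (hc hψ)).integrable_of_hasCompactSupport
      hφ.hasCompactSupport.mul_right)
    ((hφ.contDiff.continuous.mul hψ.contDiff.continuous).integrable_of_hasCompactSupport
      hφ.hasCompactSupport.mul_right)
    (fun x _ => hφ.differentiable x) (fun x _ => hψ.differentiable x)

/-- Smooth nonlinear functions vanishing at `0` act on test functions by composition. -/
theorem comp (hφ : IsTestFunction U φ) {F : ℝ → ℝ} (hF : ContDiff ℝ ∞ F) (hF0 : F 0 = 0) :
    IsTestFunction U (F ∘ φ) where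
  contDiff := hF.comp hφ.contDiff
  hasCompactSupport := hφ.hasCompactSupport.comp_left hF0
  tsupport_subset :=
    (closure_mono (Function.support_comp_subset hF0 φ)).trans hφ.tsupport_subset

theorem gradient_comp (hφ : IsTestFunction U φ) {F : ℝ → ℝ} {F' : ℝ} (x : Euc d)
    (hF : HasDerivAt F F' (φ x)) : ∇ (F ∘ φ) x = F' • ∇ φ x := by
  have h := hF.comp_hasFDerivAt x (hφ.differentiable x).hasFDerivAt
  rw [gradient, h.fderiv, map_smul, gradient]

/-- A test function, together with its classical gradient, as an element of `H₀^{1,2}(U)`. -/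
noncomputable def toSobolev (hφ : IsTestFunction U φ) : SobolevH10 U :=
  ⟨⟨WithLp.toLp 2 (hφ.memLp.toLp φ, hφ.memLp_gradient.toLp (∇ φ)), by
    intro ψ hψ i
    refine Eq.trans (integral_congr_ae ?_) ((hφ.isWeakGradient ψ hψ i).trans
      (congrArg Neg.neg (integral_congr_ae ?_)))
    · filter_upwards [hφ.memLp.coeFn_toLp] with x hx
      change hφ.memLp.toLp φ x * _ = _
      rw [hx]
    · filter_upwards [hφ.memLp_gradient.coeFn_toLp] with x hx
      change _ = hφ.memLp_gradient.toLp (∇ φ) x i * _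
      rw [hx]⟩,
  (testFunctions U).le_topologicalClosure ⟨φ, hφ, hφ.memLp.coeFn_toLp⟩⟩

theorem sobolevFun_toSobolev (hφ : IsTestFunction U φ) :
    sobolevFun hφ.toSobolev =ᵐ[volume.restrict U] φ := hφ.memLp.coeFn_toLp

theorem sobolevGrad_toSobolev (hφ : IsTestFunction U φ) :
    sobolevGrad hφ.toSobolev =ᵐ[volume.restrict U] ∇ φ := hφ.memLp_gradient.coeFn_toLp

end IsTestFunction

theorem SobolevH10.exists_eq_toSobolev (hU : IsOpen U) {u : SobolevH10 U}
    (hu : (u : SobolevH1 U) ∈ testFunctions U) :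
    ∃ (φ : Euc d → ℝ) (hφ : IsTestFunction U φ), u = hφ.toSobolev := by
  obtain ⟨φ, hφ, hw⟩ := hu
  refine ⟨φ, hφ, Subtype.ext (SobolevH1.eq_of_fun_eq hU ?_)⟩
  exact Lp.ext (hw.trans hφ.sobolevFun_toSobolev.symm)

theorem SobolevH10.dense_testFunctions :
    Dense ((testFunctions U).comap (SobolevH10 U).subtype : Set (SobolevH10 U)) := by
  intro u
  rw [closure_subtype]
  refine closure_mono ?_ u.2
  intro w hw
  exact ⟨⟨w, (testFunctions U).le_topologicalClosure hw⟩, hw, rfl⟩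

end TestFunctions

/-! ### The Hilbert space `H₀^{1,2}(U)` -/

section Hilbert

variable {d : ℕ} {U : Set (Euc d)}

theorem isClosed_sobolevH1 : IsClosed (SobolevH1 U : Set (L2Pair U)) := by
  have : (SobolevH1 U : Set (L2Pair U)) = ⋂ (φ : Euc d → ℝ) (_ : IsTestFunction U φ) (i : Fin d),
      {w : L2Pair U | ∫ x in U, w.fst x * partialDeriv i φ x
        = - ∫ x in U, w.snd x i * φ x} := by
    ext w
    simp only [Set.mem_iInter]
    rfl
  rw [this]
  refine isClosed_iInter fun φ => isClosed_iInter fun hφ => isClosed_iInter fun i => ?_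
  -- Both sides are inner products with fixed elements of `L²`, hence continuous in `w`.
  have hg : MemLp (partialDeriv i φ) 2 (volume.restrict U) := by
    have := (EuclideanSpace.proj (𝕜 := ℝ) i).comp_memLp' hφ.memLp_gradient
    refine this.congr_norm ?_ ?_
    · exact ((hφ.contDiff.continuous_fderiv (by simp)).clm_apply
        continuous_const).aestronglyMeasurable
    · exact .of_forall fun x => congrArg _ (IsTestFunction.gradient_apply x i)
  have hs : MemLp (fun x => φ x • (EuclideanSpace.single i (1 : ℝ) : Euc d)) 2
      (volume.restrict U) :=
    hφ.memLp.congr_norm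
      (hφ.contDiff.continuous.smul continuous_const).aestronglyMeasurable
      (.of_forall fun x => by simp [norm_smul])
  have e1 : ∀ w : L2Pair U, ∫ x in U, w.fst x * partialDeriv i φ x
      = inner ℝ (hg.toLp _) w.fst := by
    intro w
    rw [L2.inner_def]
    refine integral_congr_ae ?_
    filter_upwards [hg.coeFn_toLp] with x hx
    rw [hx]
    simp
  have e2 : ∀ w : L2Pair U, ∫ x in U, w.snd x i * φ x = inner ℝ (hs.toLp _) w.snd := by
    intro w
    rw [L2.inner_def]
    refine integral_congr_ae ?_
    filter_upwards [hs.coeFn_toLp] with x hx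
    rw [hx, real_inner_smul_left, EuclideanSpace.inner_single_left]
    simp [mul_comm]
  simp only [e1, e2]
  have c1 : Continuous fun w : L2Pair U => w.fst := (WithLp.fstL 2 ℝ _ _).continuous
  have c2 : Continuous fun w : L2Pair U => w.snd := (WithLp.sndL 2 ℝ _ _).continuous
  exact isClosed_eq (continuous_const.inner c1) (continuous_const.inner c2).neg

instance : CompleteSpace (SobolevH1 U) := isClosed_sobolevH1.completeSpace_coe

instance : CompleteSpace (SobolevH10 U) :=
  (testFunctions U).isClosed_topologicalClosure.completeSpace_coe

variable (U) in
/-- The inclusion `H₀^{1,2}(U) → L²(U)`. -/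
noncomputable def sobolevFunL : SobolevH10 U →L[ℝ] Lp ℝ 2 (volume.restrict U) :=
  WithLp.fstL 2 ℝ _ _ ∘L (SobolevH1 U).subtypeL ∘L (SobolevH10 U).subtypeL

variable (U) in
/-- The weak gradient `H₀^{1,2}(U) → L²(U, ℝᵈ)`. -/
noncomputable def sobolevGradL : SobolevH10 U →L[ℝ] Lp (Euc d) 2 (volume.restrict U) :=
  WithLp.sndL 2 ℝ _ _ ∘L (SobolevH1 U).subtypeL ∘L (SobolevH10 U).subtypeL

theorem sobolevFun_add (u v : SobolevH10 U) : sobolevFun (u + v) = sobolevFun u + sobolevFun v :=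
  (sobolevFunL U).map_add u v

theorem sobolevFun_smul (c : ℝ) (u : SobolevH10 U) : sobolevFun (c • u) = c • sobolevFun u :=
  (sobolevFunL U).map_smul c u

theorem SobolevH10.norm_sq_eq (u : SobolevH10 U) :
    ‖u‖ ^ 2 = ‖sobolevFun u‖ ^ 2 + ‖sobolevGrad u‖ ^ 2 :=
  WithLp.prod_norm_sq_eq_of_L2 (u : SobolevH1 U).1

theorem norm_sobolevFun_le (u : SobolevH10 U) : ‖sobolevFun u‖ ≤ ‖u‖ :=
  le_of_sq_le_sq (by rw [SobolevH10.norm_sq_eq u]; linarith [sq_nonneg ‖sobolevGrad u‖])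
    (norm_nonneg _)

theorem norm_sobolevGrad_le (u : SobolevH10 U) : ‖sobolevGrad u‖ ≤ ‖u‖ :=
  le_of_sq_le_sq (by rw [SobolevH10.norm_sq_eq u]; linarith [sq_nonneg ‖sobolevFun u‖])
    (norm_nonneg _)

end Hilbert

/-! ### Sobolev and Poincaré inequalities -/

section Sobolev

/-- The Sobolev exponent `2* = 2d / (d - 2)`, given by `1 / 2* = 1 / 2 - 1 / d`. -/
noncomputable def sobolevExponent (d : ℕ) : ℝ≥0 := (2⁻¹ - (d : ℝ≥0)⁻¹)⁻¹

variable {d : ℕ} {U : Set (Euc d)}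

theorem inv_sobolevExponent (hd : 3 ≤ d) :
    ((sobolevExponent d : ℝ≥0) : ℝ)⁻¹ = 2⁻¹ - (d : ℝ)⁻¹ := by
  have : ((d : ℝ≥0))⁻¹ ≤ 2⁻¹ := by
    gcongr
    exact_mod_cast (by omega : 2 ≤ d)
  rw [sobolevExponent, NNReal.coe_inv, inv_inv, NNReal.coe_sub this]
  simp

theorem sobolevExponent_pos (hd : 3 ≤ d) : 0 < sobolevExponent d := by
  have h := inv_sobolevExponent hd
  have : (d : ℝ)⁻¹ < 2⁻¹ := by
    gcongr
    exact_mod_cast (by omega : 2 < d)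
  have h2 : 0 < ((sobolevExponent d : ℝ≥0) : ℝ)⁻¹ := by rw [h]; linarith
  exact_mod_cast inv_pos.1 h2

theorem holderTriple_sobolevExponent (hd : 3 ≤ d) :
    ENNReal.HolderTriple (sobolevExponent d : ℝ≥0∞) (d : ℝ≥0∞) 2 where
  inv_add_inv_eq_inv := by
    have h0 : (d : ℝ≥0) ≠ 0 := by
      norm_cast
      omega
    have h : (sobolevExponent d)⁻¹ + (d : ℝ≥0)⁻¹ = 2⁻¹ := by
      apply NNReal.eq
      push_cast
      rw [inv_sobolevExponent hd]
      ring
    have h2 := congrArg (fun t : ℝ≥0 => (t : ℝ≥0∞)) h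
    simp only [ENNReal.coe_add] at h2
    rw [ENNReal.coe_inv (sobolevExponent_pos hd).ne', ENNReal.coe_inv h0,
      ENNReal.coe_inv two_ne_zero] at h2
    simpa using h2

/-- The **Sobolev inequality** on `H₀^{1,2}(U)`. -/
theorem exists_eLpNorm_sobolevFun_le (hd : 3 ≤ d) (hU : IsOpen U) :
    ∃ C : ℝ≥0, ∀ u : SobolevH10 U,
      eLpNorm (sobolevFun u) (sobolevExponent d) (volume.restrict U) ≤ C * ‖sobolevGrad u‖ₑ := by
  refine ⟨SNormLESNormFDerivOfEqConst ℝ (volume : Measure (Euc d)) (2 : ℝ≥0), ?_⟩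
  refine fun u => (SobolevH10.dense_testFunctions (U := U)).induction (P := fun u : SobolevH10 U =>
    eLpNorm (sobolevFun u) (sobolevExponent d) (volume.restrict U) ≤ _ * ‖sobolevGrad u‖ₑ) ?_ ?_ u
  · intro u hu
    obtain ⟨φ, hφ, rfl⟩ := SobolevH10.exists_eq_toSobolev hU hu
    have h := eLpNorm_le_eLpNorm_fderiv_of_eq (volume : Measure (Euc d))
      (hφ.contDiff.of_le (by simp)) hφ.hasCompactSupport (p := 2) (p' := sobolevExponent d)
      (by norm_num) (by simp; omega) (by simpa using inv_sobolevExponent hd)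
    have h2 : eLpNorm (fderiv ℝ φ) (2 : ℝ≥0) volume = ‖sobolevGrad hφ.toSobolev‖ₑ := by
      have hn : eLpNorm (fderiv ℝ φ) (2 : ℝ≥0) volume = eLpNorm (∇ φ) 2 volume :=
        eLpNorm_congr_norm_ae (.of_forall fun x => by
          rw [gradient, LinearIsometryEquiv.norm_map])
      have hs : U.indicator (∇ φ) = ∇ φ := by
        rw [Set.indicator_eq_self]
        refine fun x hx => hφ.tsupport_subset (support_fderiv_subset ℝ ?_)
        intro h0
        exact hx (by rw [gradient, h0, map_zero])
      rw [hn, Lp.enorm_def, eLpNorm_congr_ae hφ.sobolevGrad_toSobolev, ← hs,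
        eLpNorm_indicator_eq_eLpNorm_restrict hU.measurableSet, hs]
    rw [eLpNorm_congr_ae hφ.sobolevFun_toSobolev, ← h2]
    exact (eLpNorm_mono_measure φ Measure.restrict_le_self).trans h
  · -- Lower semicontinuity of the `L^{2*}` seminorm under convergence in measure.
    refine IsSeqClosed.isClosed fun u v hu huv => ?_
    have hf : Tendsto (fun n => sobolevFun (u n)) atTop (𝓝 (sobolevFun v)) :=
      ((sobolevFunL U).continuous.tendsto v).comp huv
    have hg : Tendsto (fun n => (SNormLESNormFDerivOfEqConst ℝ (volume : Measure (Euc d))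
        (2 : ℝ≥0) : ℝ≥0∞) * ‖sobolevGrad (u n)‖ₑ) atTop (𝓝 (_ * ‖sobolevGrad v‖ₑ)) :=
      ENNReal.Tendsto.const_mul
        (((continuous_enorm.comp (sobolevGradL U).continuous).tendsto v).comp huv)
        (Or.inr ENNReal.coe_ne_top)
    have hv : ∀ b > (SNormLESNormFDerivOfEqConst ℝ (volume : Measure (Euc d)) (2 : ℝ≥0) : ℝ≥0∞)
        * ‖sobolevGrad v‖ₑ,
        eLpNorm (sobolevFun v) (sobolevExponent d) (volume.restrict U) ≤ b := fun b hb =>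
      eLpNorm_le_of_tendstoInMeasure
        ((hg.eventually (gt_mem_nhds hb)).mono fun n hn => (hu n).trans hn.le)
        (tendstoInMeasure_of_tendsto_Lp hf) (fun n => Lp.aestronglyMeasurable _)
    exact le_of_forall_gt_imp_ge_of_dense hv

theorem two_le_sobolevExponent (hd : 3 ≤ d) : (2 : ℝ≥0∞) ≤ sobolevExponent d := by
  have h := inv_sobolevExponent hd
  have h2 : ((sobolevExponent d : ℝ≥0) : ℝ)⁻¹ ≤ 2⁻¹ := by
    rw [h]
    simp
  have h3 : (2 : ℝ) ≤ sobolevExponent d :=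
    (inv_le_inv₀ (by exact_mod_cast sobolevExponent_pos hd) (by norm_num)).1 h2
  exact_mod_cast h3

/-- Splitting `f` at height `k` bounds its `L²` norm by the part below `k` and the `L^{2*}` norm on
the superlevel set. -/
theorem eLpNorm_two_le_of_superlevel (hd : 3 ≤ d) {μ : Measure (Euc d)} {f : Euc d → ℝ}
    (hf : StronglyMeasurable f) (k : ℝ≥0) :
    eLpNorm f 2 μ ≤ k * μ Set.univ ^ (2⁻¹ : ℝ) +
      eLpNorm f (sobolevExponent d) μ * μ {x | (k : ℝ) ≤ ‖f x‖} ^ (d : ℝ)⁻¹ := by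
  set S : Set (Euc d) := {x | (k : ℝ) ≤ ‖f x‖} with hS
  have hSm : MeasurableSet S := measurableSet_le measurable_const hf.norm.measurable
  have hsplit : f = Sᶜ.indicator f + S.indicator f := by
    rw [add_comm, Set.indicator_self_add_compl]
  have h1 : eLpNorm (Sᶜ.indicator f) 2 μ ≤ k * μ Set.univ ^ (2⁻¹ : ℝ) := by
    have := eLpNorm_le_of_ae_bound (p := 2) (μ := μ) (f := Sᶜ.indicator f) (C := k)
      (.of_forall fun x => by
        by_cases hx : x ∈ Sᶜ
        · rw [Set.indicator_of_mem hx]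
          exact (not_le.1 (show ¬ (k : ℝ) ≤ ‖f x‖ from hx)).le
        · rw [Set.indicator_of_notMem hx, norm_zero]
          exact k.2)
    rw [mul_comm]
    simpa using this
  have h2 : eLpNorm (S.indicator f) 2 μ ≤
      eLpNorm f (sobolevExponent d) μ * μ S ^ (d : ℝ)⁻¹ := by
    rw [eLpNorm_indicator_eq_eLpNorm_restrict hSm]
    have := eLpNorm_le_eLpNorm_mul_rpow_measure_univ (μ := μ.restrict S)
      (two_le_sobolevExponent hd) hf.aestronglyMeasurable
    rw [Measure.restrict_apply_univ] at this
    have he : 1 / (2 : ℝ≥0∞).toReal - 1 / ((sobolevExponent d : ℝ≥0) : ℝ≥0∞).toReal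
        = (d : ℝ)⁻¹ := by
      rw [ENNReal.coe_toReal, one_div, one_div, inv_sobolevExponent hd]
      simp
    rw [he] at this
    refine this.trans ?_
    gcongr
    exact Measure.restrict_le_self
  calc eLpNorm f 2 μ = eLpNorm (Sᶜ.indicator f + S.indicator f) 2 μ := by rw [← hsplit]
    _ ≤ eLpNorm (Sᶜ.indicator f) 2 μ + eLpNorm (S.indicator f) 2 μ :=
      eLpNorm_add_le (hf.indicator hSm.compl).aestronglyMeasurable
        (hf.indicator hSm).aestronglyMeasurable (by norm_num)
    _ ≤ _ := add_le_add h1 h2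

theorem enorm_le_add_mul_enorm_iff {E F : Type*} [NormedAddCommGroup E] [NormedAddCommGroup F]
    {x : E} {y : F} {a b : ℝ} (ha : 0 ≤ a) (hb : 0 ≤ b) :
    ‖x‖ₑ ≤ ENNReal.ofReal a + ENNReal.ofReal b * ‖y‖ₑ ↔ ‖x‖ ≤ a + b * ‖y‖ := by
  rw [← ofReal_norm, ← ofReal_norm, ← ENNReal.ofReal_mul hb,
    ← ENNReal.ofReal_add ha (by positivity), ENNReal.ofReal_le_ofReal_iff (by positivity)]

/-- If the superlevel sets of `u` are small, the gradient controls the `L²` norm with a small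
constant, at the price of an additive constant. -/
theorem exists_norm_sobolevFun_le_add (hd : 3 ≤ d) (hU : IsOpen U) (hUb : Bornology.IsBounded U)
    {η : ℝ} (hη : 0 < η) :
    ∃ δ : ℝ, 0 < δ ∧ ∀ k : ℝ≥0, ∃ K : ℝ, 0 ≤ K ∧ ∀ u : SobolevH10 U,
      volume.restrict U {x | (k : ℝ) ≤ ‖sobolevFun u x‖} ≤ ENNReal.ofReal δ →
        ‖sobolevFun u‖ ≤ K + η * ‖sobolevGrad u‖ := by
  obtain ⟨C, hC⟩ := exists_eLpNorm_sobolevFun_le hd hU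
  have hd0 : (d : ℝ) ≠ 0 := by
    norm_cast
    omega
  have hd1 : (0 : ℝ) ≤ (d : ℝ)⁻¹ := by positivity
  have hC1 : (0 : ℝ) < C + 1 := by positivity
  refine ⟨(η / (C + 1)) ^ (d : ℝ), by positivity, fun k => ⟨(k * volume U ^ (2⁻¹ : ℝ)).toReal,
    ENNReal.toReal_nonneg, fun u hu => ?_⟩⟩
  have hfin : (k * volume U ^ (2⁻¹ : ℝ) : ℝ≥0∞) ≠ ⊤ :=
    ENNReal.mul_ne_top ENNReal.coe_ne_top
      (ENNReal.rpow_ne_top_of_nonneg (by norm_num) hUb.measure_lt_top.ne)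
  rw [← enorm_le_add_mul_enorm_iff ENNReal.toReal_nonneg hη.le, ENNReal.ofReal_toReal hfin,
    Lp.enorm_def]
  refine (eLpNorm_two_le_of_superlevel hd (Lp.stronglyMeasurable _) k).trans ?_
  rw [Measure.restrict_apply_univ]
  refine add_le_add le_rfl ?_
  calc _ ≤ (C * ‖sobolevGrad u‖ₑ) * (ENNReal.ofReal ((η / (C + 1)) ^ (d : ℝ))) ^ (d : ℝ)⁻¹ := by
        exact mul_le_mul' (hC u) (ENNReal.rpow_le_rpow hu hd1)
    _ = (C * ENNReal.ofReal (η / (C + 1))) * ‖sobolevGrad u‖ₑ := by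
        rw [ENNReal.ofReal_rpow_of_nonneg (by positivity) (by positivity),
          Real.rpow_rpow_inv (by positivity) hd0]
        ring
    _ ≤ ENNReal.ofReal η * ‖sobolevGrad u‖ₑ := by
        gcongr
        rw [← ENNReal.ofReal_coe_nnreal, ← ENNReal.ofReal_mul C.coe_nonneg]
        apply ENNReal.ofReal_le_ofReal
        rw [mul_div_assoc', div_le_iff₀ hC1]
        nlinarith

/-- The **Poincaré inequality** on `H₀^{1,2}(U)`, for bounded `U`. -/
theorem exists_norm_sobolevFun_le (hd : 3 ≤ d) (hU : IsOpen U) (hUb : Bornology.IsBounded U) :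
    ∃ C : ℝ, 0 ≤ C ∧ ∀ u : SobolevH10 U, ‖sobolevFun u‖ ≤ C * ‖sobolevGrad u‖ := by
  obtain ⟨C, hC⟩ := exists_eLpNorm_sobolevFun_le hd hU
  have hfin : (C * volume U ^ (d : ℝ)⁻¹ : ℝ≥0∞) ≠ ⊤ :=
    ENNReal.mul_ne_top ENNReal.coe_ne_top
      (ENNReal.rpow_ne_top_of_nonneg (inv_nonneg.2 d.cast_nonneg) hUb.measure_lt_top.ne)
  refine ⟨_, ENNReal.toReal_nonneg (a := C * volume U ^ (d : ℝ)⁻¹), fun u => ?_⟩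
  have h := eLpNorm_two_le_of_superlevel (μ := volume.restrict U) hd
    (Lp.stronglyMeasurable (sobolevFun u)) 0
  have h2 : ‖sobolevFun u‖ₑ ≤ ENNReal.ofReal 0
      + ENNReal.ofReal (C * volume U ^ (d : ℝ)⁻¹).toReal * ‖sobolevGrad u‖ₑ := by
    rw [ENNReal.ofReal_toReal hfin, Lp.enorm_def]
    refine h.trans ?_
    simp only [ENNReal.coe_zero, zero_mul, zero_add, ENNReal.ofReal_zero, NNReal.coe_zero,
      norm_nonneg, Set.ofPred_true, Measure.restrict_apply_univ]
    rw [mul_right_comm]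
    gcongr
    exact hC u
  simpa using (enorm_le_add_mul_enorm_iff le_rfl ENNReal.toReal_nonneg).1 h2

/-- The Sobolev norm on `H₀^{1,2}(U)` is controlled by the norm of the gradient. -/
theorem exists_norm_le_norm_sobolevGrad (hd : 3 ≤ d) (hU : IsOpen U)
    (hUb : Bornology.IsBounded U) :
    ∃ C : ℝ, 0 < C ∧ ∀ u : SobolevH10 U, ‖u‖ ≤ C * ‖sobolevGrad u‖ := by
  obtain ⟨C, hC0, hC⟩ := exists_norm_sobolevFun_le hd hU hUb
  refine ⟨C + 1, by positivity, fun u => ?_⟩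
  refine le_of_sq_le_sq ?_ (by positivity)
  rw [SobolevH10.norm_sq_eq]
  have h1 : ‖sobolevFun u‖ ^ 2 ≤ (C * ‖sobolevGrad u‖) ^ 2 := by
    gcongr
    exact hC u
  nlinarith [mul_nonneg hC0 (sq_nonneg ‖sobolevGrad u‖)]

/-- An `L^d` coefficient is small in `L^d` up to a bounded part; multiplication by it therefore maps
`L^{2*}` to `L²` with small constant up to an `L²`-bounded operator. -/
theorem exists_eLpNorm_smul_le (hd : 3 ≤ d) {μ : Measure (Euc d)} {H : Euc d → Euc d}
    (hH : MemLp H (d : ℝ≥0∞) μ) {ε : ℝ} (hε : 0 < ε) :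
    ∃ N : ℝ≥0, ∀ f : Euc d → ℝ, AEStronglyMeasurable f μ →
      eLpNorm (fun x => f x • H x) 2 μ ≤
        ENNReal.ofReal ε * eLpNorm f (sobolevExponent d) μ + N * eLpNorm f 2 μ := by
  have := holderTriple_sobolevExponent hd
  set G := hH.1.mk H
  have hG : StronglyMeasurable G := hH.1.stronglyMeasurable_mk
  have hGm : MemLp G (d : ℝ≥0∞) μ := hH.ae_eq hH.1.ae_eq_mk
  obtain ⟨N, hN⟩ := hGm.eLpNorm_indicator_norm_ge_le hG hε
  set S : Set (Euc d) := {x | N ≤ ‖G x‖₊}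
  have hSm : MeasurableSet S := measurableSet_le measurable_const hG.norm.measurable
  refine ⟨N.toNNReal, fun f hf => ?_⟩
  have h0 : (fun x => f x • H x) =ᵐ[μ] f • S.indicator G + f • Sᶜ.indicator G := by
    filter_upwards [hH.1.ae_eq_mk] with x hx
    rw [hx, ← smul_add, Set.indicator_self_add_compl]
    rfl
  rw [eLpNorm_congr_ae h0]
  refine (eLpNorm_add_le (hf.smul (hG.indicator hSm).aestronglyMeasurable)
    (hf.smul (hG.indicator hSm.compl).aestronglyMeasurable) (by norm_num)).trans ?_
  gcongr
  · rw [mul_comm]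
    refine (eLpNorm_smul_le_mul_eLpNorm (p := sobolevExponent d) (q := d)
      (hG.indicator hSm).aestronglyMeasurable hf).trans ?_
    gcongr
  · refine eLpNorm_le_nnreal_smul_eLpNorm_of_ae_le_mul (.of_forall fun x => ?_) 2
    rw [← NNReal.coe_le_coe]
    push_cast
    rw [Pi.smul_apply', norm_smul, mul_comm]
    gcongr
    by_cases hx : x ∈ Sᶜ
    · rw [Set.indicator_of_mem hx]
      exact (not_le.1 (show ¬ N ≤ ‖G x‖₊ from hx)).le.trans (Real.le_coe_toNNReal N)
    · rw [Set.indicator_of_notMem hx, norm_zero]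
      exact N.toNNReal.2

end Sobolev

/-! ### The bounded operators in the bilinear form -/

section Operators

variable {d : ℕ} {U : Set (Euc d)}

theorem norm_toEuclideanLin_le {B : Matrix (Fin d) (Fin d) ℝ} {M : ℝ} (hB : ∀ i j, |B i j| ≤ M)
    (ξ : Euc d) : ‖B.toEuclideanLin ξ‖ ≤ d * (d * M) * ‖ξ‖ := by
  have hcoord : ∀ i, |B.toEuclideanLin ξ i| ≤ d * M * ‖ξ‖ := by
    intro i
    calc |B.toEuclideanLin ξ i| = |∑ j, B i j * ξ j| := rfl
      _ ≤ ∑ j, |B i j * ξ j| := Finset.abs_sum_le_sum_abs _ _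
      _ ≤ ∑ _j : Fin d, M * ‖ξ‖ := by
        refine Finset.sum_le_sum fun j _ => ?_
        rw [abs_mul]
        exact mul_le_mul (hB i j) (PiLp.norm_apply_le ξ j) (abs_nonneg _)
          ((abs_nonneg _).trans (hB i j))
      _ = d * M * ‖ξ‖ := by simp [mul_assoc]
  have hsum := (EuclideanSpace.basisFun (Fin d) ℝ).sum_repr (B.toEuclideanLin ξ)
  calc ‖B.toEuclideanLin ξ‖
      = ‖∑ i, (EuclideanSpace.basisFun (Fin d) ℝ).repr (B.toEuclideanLin ξ) i •
          EuclideanSpace.basisFun (Fin d) ℝ i‖ := by rw [hsum]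
    _ ≤ ∑ i, ‖(EuclideanSpace.basisFun (Fin d) ℝ).repr (B.toEuclideanLin ξ) i •
          EuclideanSpace.basisFun (Fin d) ℝ i‖ := norm_sum_le _ _
    _ ≤ ∑ _i : Fin d, d * M * ‖ξ‖ := by
        refine Finset.sum_le_sum fun i _ => ?_
        rw [norm_smul, OrthonormalBasis.norm_eq_one, mul_one]
        exact hcoord i
    _ = d * (d * M) * ‖ξ‖ := by simp [mul_assoc]

/-- Multiplication by a bounded measurable matrix is a bounded operator on `L²(U, ℝᵈ)`. -/
theorem IsUniformlyElliptic.exists_matrixMul {A : Euc d → Matrix (Fin d) (Fin d) ℝ} {M lam : ℝ}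
    (hA : IsUniformlyElliptic A M lam) :
    ∃ MA : Lp (Euc d) 2 (volume.restrict U) →L[ℝ] Lp (Euc d) 2 (volume.restrict U),
      ∀ G, MA G =ᵐ[volume.restrict U] fun x => (A x).toEuclideanLin (G x) := by
  have hbd : ∀ G : Lp (Euc d) 2 (volume.restrict U), ∀ᵐ x ∂volume.restrict U,
      ‖(A x).toEuclideanLin (G x)‖ ≤ d * (d * M) * ‖G x‖ := fun G => by
    filter_upwards [ae_restrict_of_ae hA.bounded] with x hx
    exact norm_toEuclideanLin_le hx _
  have hmem : ∀ G : Lp (Euc d) 2 (volume.restrict U),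
      MemLp (fun x => (A x).toEuclideanLin (G x)) 2 (volume.restrict U) := fun G => by
    refine (Lp.memLp G).of_le_mul (AEMeasurable.aestronglyMeasurable ?_) (hbd G)
    have hG : ∀ j, AEMeasurable (fun x => G x j) (volume.restrict U) :=
      fun j => (memLp_two_coord j G).1.aemeasurable
    refine (WithLp.measurable_toLp 2 (Fin d → ℝ)).comp_aemeasurable
      (aemeasurable_pi_lambda (fun x i => ∑ j, A x i j * G x j) fun i => ?_)
    exact Finset.aemeasurable_fun_sum _ fun j _ => ((hA.aemeasurable i j).restrict).mul (hG j)
  let L : Lp (Euc d) 2 (volume.restrict U) →ₗ[ℝ] Lp (Euc d) 2 (volume.restrict U) :=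
    { toFun := fun G => (hmem G).toLp _
      map_add' := fun F G => by
        rw [← MemLp.toLp_add]
        refine MemLp.toLp_congr _ _ ?_
        filter_upwards [Lp.coeFn_add F G] with x hx
        rw [hx, Pi.add_apply, map_add, Pi.add_apply]
      map_smul' := fun c G => by
        rw [RingHom.id_apply, ← MemLp.toLp_const_smul]
        refine MemLp.toLp_congr _ _ ?_
        filter_upwards [Lp.coeFn_smul c G] with x hx
        rw [hx, Pi.smul_apply, map_smul, Pi.smul_apply] }
  refine ⟨L.mkContinuous (d * (d * M)) fun G => ?_, fun G => (hmem G).coeFn_toLp⟩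
  refine Lp.norm_le_mul_norm_of_ae_le_mul ?_
  filter_upwards [hbd G, (hmem G).coeFn_toLp] with x hx hx2
  change ‖(hmem G).toLp _ x‖ ≤ _
  rw [hx2]
  exact hx

/-- For `H ∈ L^d`, the `L²` norm of `u H` is controlled by the gradient of `u` with an arbitrarily
small constant, up to a multiple of the `L²` norm of `u`. -/
theorem exists_eLpNorm_sobolevFun_smul_le (hd : 3 ≤ d) (hU : IsOpen U) {H : Euc d → Euc d}
    (hH : MemLp H (d : ℝ≥0∞) (volume.restrict U)) {ε : ℝ} (hε : 0 < ε) :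
    ∃ N : ℝ, 0 ≤ N ∧ ∀ u : SobolevH10 U,
      eLpNorm (fun x => sobolevFun u x • H x) 2 (volume.restrict U) ≤
        ENNReal.ofReal (ε * ‖sobolevGrad u‖ + N * ‖sobolevFun u‖) := by
  obtain ⟨C, hC⟩ := exists_eLpNorm_sobolevFun_le hd hU
  have hC1 : (0 : ℝ) < C + 1 := by positivity
  obtain ⟨N, hN⟩ := exists_eLpNorm_smul_le hd hH (ε := ε / (C + 1)) (by positivity)
  refine ⟨N, N.2, fun u => (hN _ (Lp.aestronglyMeasurable _)).trans ?_⟩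
  rw [ENNReal.ofReal_add (by positivity) (by positivity), ENNReal.ofReal_mul hε.le,
    ENNReal.ofReal_mul N.coe_nonneg, ofReal_norm, ofReal_norm, ENNReal.ofReal_coe_nnreal,
    ← Lp.enorm_def (sobolevFun u)]
  refine add_le_add ?_ le_rfl
  calc _ ≤ ENNReal.ofReal (ε / (C + 1)) * (C * ‖sobolevGrad u‖ₑ) := by
        gcongr
        exact hC u
    _ = ENNReal.ofReal (ε / (C + 1) * C) * ‖sobolevGrad u‖ₑ := by
        rw [ENNReal.ofReal_mul (by positivity), ENNReal.ofReal_coe_nnreal, mul_assoc]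
    _ ≤ _ := by
        gcongr
        rw [div_mul_eq_mul_div, div_le_iff₀ hC1]
        nlinarith

/-- For `H ∈ L^d`, the map `u ↦ u H` is bounded from `H₀^{1,2}(U)` to `L²(U, ℝᵈ)`. -/
theorem exists_driftMul (hd : 3 ≤ d) (hU : IsOpen U) {H : Euc d → Euc d}
    (hH : MemLp H (d : ℝ≥0∞) (volume.restrict U)) :
    ∃ K : SobolevH10 U →L[ℝ] Lp (Euc d) 2 (volume.restrict U),
      ∀ u, K u =ᵐ[volume.restrict U] fun x => sobolevFun u x • H x := by
  obtain ⟨N, hN0, hN⟩ := exists_eLpNorm_sobolevFun_smul_le hd hU hH one_pos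
  have hmem : ∀ u : SobolevH10 U,
      MemLp (fun x => sobolevFun u x • H x) 2 (volume.restrict U) := fun u =>
    ⟨(Lp.aestronglyMeasurable (sobolevFun u)).smul hH.1, (hN u).trans_lt ENNReal.ofReal_lt_top⟩
  let L : SobolevH10 U →ₗ[ℝ] Lp (Euc d) 2 (volume.restrict U) :=
    { toFun := fun u => (hmem u).toLp _
      map_add' := fun u v => by
        rw [← MemLp.toLp_add]
        refine MemLp.toLp_congr _ _ ?_
        filter_upwards [Lp.coeFn_add (sobolevFun u) (sobolevFun v)] with x hx
        rw [sobolevFun_add, hx, Pi.add_apply, add_smul, Pi.add_apply]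
      map_smul' := fun c u => by
        refine (MemLp.toLp_congr _ ((hmem u).const_smul c) ?_).trans
          (MemLp.toLp_const_smul c (hmem u))
        filter_upwards [Lp.coeFn_smul c (sobolevFun u)] with x hx
        rw [sobolevFun_smul, hx, Pi.smul_apply, Pi.smul_apply, smul_eq_mul, mul_smul] }
  have hL : ∀ u, ‖L u‖ ≤ (1 + N) * ‖u‖ := fun u =>
    calc ‖L u‖ ≤ 1 * ‖sobolevGrad u‖ + N * ‖sobolevFun u‖ :=
          (Lp.norm_toLp _ (hmem u)).trans_le
            (ENNReal.toReal_le_of_le_ofReal (by positivity) (hN u))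
      _ ≤ 1 * ‖u‖ + N * ‖u‖ :=
          add_le_add (mul_le_mul_of_nonneg_left (norm_sobolevGrad_le u) zero_le_one)
            (mul_le_mul_of_nonneg_left (norm_sobolevFun_le u) hN0)
      _ = (1 + N) * ‖u‖ := (add_mul _ _ _).symm
  exact ⟨L.mkContinuous (1 + N) hL, fun u => (hmem u).coeFn_toLp⟩

theorem mul_inner_le_inner_of_ae {α E F : Type*} [MeasurableSpace α] {μ : Measure α}
    [NormedAddCommGroup E] [InnerProductSpace ℝ E] [NormedAddCommGroup F] [InnerProductSpace ℝ F]
    {f g : Lp E 2 μ} {f' g' : Lp F 2 μ} {c : ℝ}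
    (h : ∀ᵐ x ∂μ, c * inner ℝ (f x) (g x) ≤ inner ℝ (f' x) (g' x)) :
    c * inner ℝ f g ≤ inner ℝ f' g' := by
  rw [L2.inner_def, L2.inner_def, ← integral_const_mul]
  exact integral_mono_ae ((L2.integrable_inner f g).const_mul c) (L2.integrable_inner f' g') h

/-- Ellipticity, integrated. -/
theorem IsUniformlyElliptic.mul_norm_sq_le {A : Euc d → Matrix (Fin d) (Fin d) ℝ} {M lam : ℝ}
    (hA : IsUniformlyElliptic A M lam)
    {MA : Lp (Euc d) 2 (volume.restrict U) → Lp (Euc d) 2 (volume.restrict U)}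
    (hMA : ∀ G, MA G =ᵐ[volume.restrict U] fun x => (A x).toEuclideanLin (G x))
    (G : Lp (Euc d) 2 (volume.restrict U)) : lam * ‖G‖ ^ 2 ≤ inner ℝ (MA G) G := by
  rw [← real_inner_self_eq_norm_sq]
  apply mul_inner_le_inner_of_ae
  filter_upwards [ae_restrict_of_ae hA.elliptic, hMA G] with x hx hx2
  rw [real_inner_self_eq_norm_sq, hx2]
  exact hx _

end Operators

/-! ### The a priori estimate -/

section APriori

variable {d : ℕ} {U : Set (Euc d)}

/-- Testing the equation for `u = φ` with `v = arctan φ` bounds the gradient of `w = arsinh φ`,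
because
`⟨A∇φ, ∇ arctan φ⟩ = ⟨A∇ arsinh φ, ∇ arsinh φ⟩` and
`φ ⟨H, ∇ arctan φ⟩ = φ (1 + φ²)^{-1/2} ⟨H, ∇ arsinh φ⟩`, where `|φ (1 + φ²)^{-1/2}| ≤ 1`. -/
theorem norm_grad_arsinh_le {A : Euc d → Matrix (Fin d) (Fin d) ℝ} {M lam : ℝ} (hlam : 0 < lam)
    (hA : IsUniformlyElliptic A M lam)
    {MA : Lp (Euc d) 2 (volume.restrict U) → Lp (Euc d) 2 (volume.restrict U)}
    (hMA : ∀ G, MA G =ᵐ[volume.restrict U] fun x => (A x).toEuclideanLin (G x))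
    {H : Euc d → Euc d} (hH : MemLp H 2 (volume.restrict U))
    {K : SobolevH10 U → Lp (Euc d) 2 (volume.restrict U)}
    (hK : ∀ u, K u =ᵐ[volume.restrict U] fun x => sobolevFun u x • H x)
    {C : ℝ} (hC0 : 0 ≤ C) (hC : ∀ u : SobolevH10 U, ‖u‖ ≤ C * ‖sobolevGrad u‖)
    {t : ℝ} (ht : t ∈ Set.Icc (0 : ℝ) 1) {φ : Euc d → ℝ} (hφ : Continuous φ)
    {z u v w : SobolevH10 U} (hz : ‖z‖ ≤ 1)
    (hzv : inner ℝ (MA (sobolevGrad u) + t • K u) (sobolevGrad v) = inner ℝ z v)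
    (huf : sobolevFun u =ᵐ[volume.restrict U] φ)
    (hu : sobolevGrad u =ᵐ[volume.restrict U] ∇ φ)
    (hv : sobolevGrad v =ᵐ[volume.restrict U] fun x => (1 + φ x ^ 2)⁻¹ • ∇ φ x)
    (hw : sobolevGrad w =ᵐ[volume.restrict U] fun x => (√(1 + φ x ^ 2))⁻¹ • ∇ φ x) :
    ‖sobolevGrad w‖ ≤ (C + ‖hH.toLp H‖) / lam := by
  have hsq : ∀ x, (1 + φ x ^ 2)⁻¹ = (√(1 + φ x ^ 2))⁻¹ * (√(1 + φ x ^ 2))⁻¹ := fun x => by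
    rw [← mul_inv, Real.mul_self_sqrt (by positivity)]
  have hone : ∀ x, (√(1 + φ x ^ 2))⁻¹ ≤ 1 := fun x =>
    inv_le_one_of_one_le₀ (Real.one_le_sqrt.2 (by nlinarith [sq_nonneg (φ x)]))
  have hquot : ∀ x, ‖φ x * (√(1 + φ x ^ 2))⁻¹‖ ≤ 1 := fun x => by
    rw [norm_mul, norm_inv, Real.norm_of_nonneg (Real.sqrt_nonneg _), ← div_eq_mul_inv,
      div_le_one (by positivity)]
    exact Real.abs_le_sqrt (by linarith)
  have h1 : lam * ‖sobolevGrad w‖ ^ 2 ≤ inner ℝ (MA (sobolevGrad u)) (sobolevGrad v) := by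
    rw [← real_inner_self_eq_norm_sq]
    apply mul_inner_le_inner_of_ae
    filter_upwards [ae_restrict_of_ae hA.elliptic, hMA (sobolevGrad u), hu, hw, hv]
      with x hx h1 h2 h3 h4
    rw [h1, h2, h3, h4, hsq, mul_smul]
    have := hx ((√(1 + φ x ^ 2))⁻¹ • ∇ φ x)
    rw [map_smul, real_inner_smul_left] at this
    rwa [real_inner_self_eq_norm_sq, real_inner_smul_right]
  have h2 : ‖sobolevGrad v‖ ≤ ‖sobolevGrad w‖ := by
    apply Lp.norm_le_norm_of_ae_le
    filter_upwards [hw, hv] with x h3 h4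
    rw [h3, h4, hsq, mul_smul, norm_smul, Real.norm_of_nonneg (by positivity)]
    exact mul_le_of_le_one_left (norm_nonneg _) (hone x)
  have h3 : |inner ℝ (K u) (sobolevGrad v)| ≤ ‖hH.toLp H‖ * ‖sobolevGrad w‖ := by
    have hG : MemLp (fun x => (φ x * (√(1 + φ x ^ 2))⁻¹) • H x) 2 (volume.restrict U) := by
      refine hH.of_le ?_ (.of_forall fun x => ?_)
      · have : Continuous fun x => φ x * (√(1 + φ x ^ 2))⁻¹ :=
          hφ.mul ((continuous_const.add (hφ.pow 2)).sqrt.inv₀ fun x =>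
            (Real.sqrt_pos.2 (show 0 < 1 + φ x ^ 2 by positivity)).ne')
        exact this.aestronglyMeasurable.smul hH.1
      · rw [norm_smul]
        exact mul_le_of_le_one_left (norm_nonneg _) (hquot x)
    have e : inner ℝ (K u) (sobolevGrad v) = inner ℝ (hG.toLp _) (sobolevGrad w) := by
      rw [L2.inner_def, L2.inner_def]
      refine integral_congr_ae ?_
      filter_upwards [hK u, huf, hG.coeFn_toLp, hw, hv]
        with x h1 h2 h3 h4 h5
      rw [h1, h2, h3, h4, h5, hsq]
      simp only [real_inner_smul_left, real_inner_smul_right]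
      ring
    rw [e]
    refine (abs_real_inner_le_norm _ _).trans ?_
    gcongr
    apply Lp.norm_le_norm_of_ae_le
    filter_upwards [hG.coeFn_toLp, hH.coeFn_toLp] with x h1 h2
    rw [h1, h2, norm_smul]
    exact mul_le_of_le_one_left (norm_nonneg _) (hquot x)
  rw [inner_add_left, real_inner_smul_left] at hzv
  have h5 : inner ℝ z v ≤ C * ‖sobolevGrad v‖ :=
    (real_inner_le_norm z v).trans ((mul_le_of_le_one_left (norm_nonneg _) hz).trans (hC v))
  have h6 : -(t * inner ℝ (K u) (sobolevGrad v)) ≤ ‖hH.toLp H‖ * ‖sobolevGrad w‖ := by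
    refine (neg_le_abs _).trans ?_
    rw [abs_mul, abs_of_nonneg ht.1]
    exact (mul_le_of_le_one_left (abs_nonneg _) ht.2).trans h3
  rw [le_div_iff₀ hlam]
  by_cases h0 : ‖sobolevGrad w‖ = 0
  · rw [h0, zero_mul]
    positivity
  · have hpos : 0 < ‖sobolevGrad w‖ := lt_of_le_of_ne (norm_nonneg _) (Ne.symm h0)
    refine le_of_mul_le_mul_left ?_ hpos
    nlinarith [mul_le_mul_of_nonneg_left h2 hC0]

/-- Chebyshev's inequality for `arsinh φ`: an `L²` bound makes high superlevel sets of `φ` small,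
uniformly in `φ`. -/
theorem exists_measure_superlevel_le (μ : Measure (Euc d)) (R : ℝ) {δ : ℝ} (hδ : 0 < δ) :
    ∃ k : ℝ≥0, ∀ f g : Lp ℝ 2 μ, ‖g‖ ≤ R → (g =ᵐ[μ] fun x => Real.arsinh (f x)) →
      μ {x | (k : ℝ) ≤ ‖f x‖} ≤ ENNReal.ofReal δ := by
  obtain ⟨s, hs0, hs⟩ : ∃ s : ℝ, 0 < s ∧ R ^ 2 ≤ s ^ 2 * δ := by
    refine ⟨|R| / √δ + 1, by positivity, ?_⟩
    have h : |R| ≤ (|R| / √δ + 1) * √δ := by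
      rw [add_mul, div_mul_cancel₀ _ (Real.sqrt_pos.2 hδ).ne']
      linarith [Real.sqrt_nonneg δ]
    calc R ^ 2 = |R| ^ 2 := (sq_abs R).symm
      _ ≤ ((|R| / √δ + 1) * √δ) ^ 2 := by gcongr
      _ = _ := by rw [mul_pow, Real.sq_sqrt hδ.le]
  refine ⟨(Real.sinh s).toNNReal, fun f g hg hfg => ?_⟩
  have hk : ((Real.sinh s).toNNReal : ℝ) = Real.sinh s :=
    Real.coe_toNNReal _ (Real.sinh_nonneg_iff.2 hs0.le)
  have hsub : μ {x | ((Real.sinh s).toNNReal : ℝ) ≤ ‖f x‖} ≤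
      μ {x | ENNReal.ofReal s ≤ ‖g x‖ₑ} := by
    refine measure_mono_ae ?_
    filter_upwards [hfg] with x hx hxs
    change ENNReal.ofReal s ≤ ‖g x‖ₑ
    change ((Real.sinh s).toNNReal : ℝ) ≤ ‖f x‖ at hxs
    rw [hk, Real.norm_eq_abs, le_abs] at hxs
    rw [← ofReal_norm, hx]
    apply ENNReal.ofReal_le_ofReal
    rw [Real.norm_eq_abs, le_abs]
    refine hxs.imp (fun h => ?_) (fun h => ?_)
    · rw [← Real.arsinh_sinh s]
      exact Real.arsinh_le_arsinh.2 h
    · rw [← Real.arsinh_neg, ← Real.arsinh_sinh s]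
      exact Real.arsinh_le_arsinh.2 h
  refine hsub.trans ?_
  have h := mul_meas_ge_le_pow_eLpNorm' μ (p := 2) (by norm_num) (by norm_num)
    (Lp.aestronglyMeasurable g) (ENNReal.ofReal s)
  rw [← Lp.enorm_def, ENNReal.toReal_ofNat, ENNReal.rpow_two, ENNReal.rpow_two, ← ofReal_norm,
    ← ENNReal.ofReal_pow hs0.le, ← ENNReal.ofReal_pow (norm_nonneg _)] at h
  have h2 : ENNReal.ofReal (s ^ 2) * μ {x | ENNReal.ofReal s ≤ ‖g x‖ₑ}
      ≤ ENNReal.ofReal (s ^ 2) * ENNReal.ofReal δ := by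
    rw [← ENNReal.ofReal_mul (by positivity)]
    refine h.trans (ENNReal.ofReal_le_ofReal (le_trans ?_ hs))
    gcongr
  exact (ENNReal.mul_le_mul_iff_right (by simpa using hs0.ne') ENNReal.ofReal_ne_top).1 h2

/-- The arithmetic of absorption, with `a = ‖∇u‖₂`, `b = ‖u H‖₂`, `f = ‖u‖₂`: the two drift
contributions take away at most half of the elliptic term `lam * a ^ 2`, up to a term linear in `a`. -/
theorem le_of_absorption {a b f lam C N L : ℝ} (hlam : 0 < lam) (ha : 0 ≤ a) (hC : 0 ≤ C)
    (hN : 0 ≤ N) (hL : 0 ≤ L) (hab : lam * a ^ 2 ≤ (C + b) * a) (hb : b ≤ lam / 4 * a + N * f)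
    (hf : f ≤ L + lam / (4 * (N + 1)) * a) : a ≤ 2 / lam * (C + N * L) := by
  have hNq : N * (lam / (4 * (N + 1))) ≤ lam / 4 := by
    rw [mul_div_assoc', div_le_div_iff₀ (by positivity) (by norm_num)]
    nlinarith
  have hb' : b ≤ lam / 2 * a + N * L := by
    nlinarith [mul_le_mul_of_nonneg_left hf hN, mul_le_mul_of_nonneg_right hNq ha]
  have hquad : a * (lam / 2 * a) ≤ a * (C + N * L) := by
    nlinarith [mul_le_mul_of_nonneg_right hb' ha]
  rcases ha.eq_or_lt with h0 | hpos
  · rw [← h0]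
    positivity
  · have := le_of_mul_le_mul_left hquad hpos
    rw [div_mul_eq_mul_div, le_div_iff₀ hlam]
    linarith

/-- The energy estimate obtained by testing the equation with its solution. -/
theorem IsUniformlyElliptic.energy_le {A : Euc d → Matrix (Fin d) (Fin d) ℝ} {M lam : ℝ}
    (hA : IsUniformlyElliptic A M lam)
    {MA : Lp (Euc d) 2 (volume.restrict U) → Lp (Euc d) 2 (volume.restrict U)}
    (hMA : ∀ G, MA G =ᵐ[volume.restrict U] fun x => (A x).toEuclideanLin (G x))
    {F : Lp (Euc d) 2 (volume.restrict U)} {C : ℝ} {t : ℝ} (ht : t ∈ Set.Icc (0 : ℝ) 1)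
    {u z : SobolevH10 U} (hC : ‖u‖ ≤ C * ‖sobolevGrad u‖) (hz : ‖z‖ ≤ 1)
    (hzu : inner ℝ (MA (sobolevGrad u) + t • F) (sobolevGrad u) = inner ℝ z u) :
    lam * ‖sobolevGrad u‖ ^ 2 ≤ (C + ‖F‖) * ‖sobolevGrad u‖ := by
  have hell := hA.mul_norm_sq_le hMA (sobolevGrad u)
  rw [inner_add_left, real_inner_smul_left] at hzu
  have h5 : inner ℝ z u ≤ C * ‖sobolevGrad u‖ :=
    (real_inner_le_norm z u).trans ((mul_le_of_le_one_left (norm_nonneg _) hz).trans hC)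
  have h6 : -(t * inner ℝ F (sobolevGrad u)) ≤ ‖F‖ * ‖sobolevGrad u‖ := by
    refine (neg_le_abs _).trans ?_
    rw [abs_mul, abs_of_nonneg ht.1]
    exact (mul_le_of_le_one_left (abs_nonneg _) ht.2).trans (abs_real_inner_le_norm _ _)
  rw [add_mul]
  linarith

/-- Testing with `arctan φ` confines the large values of `φ` to a small set, uniformly in `φ`. -/
theorem exists_superlevel_le_of_weakSolution (hd : 3 ≤ d) (hU : IsOpen U)
    (hUb : Bornology.IsBounded U)
    {A : Euc d → Matrix (Fin d) (Fin d) ℝ} {M lam : ℝ} (hlam : 0 < lam)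
    (hA : IsUniformlyElliptic A M lam)
    {MA : Lp (Euc d) 2 (volume.restrict U) → Lp (Euc d) 2 (volume.restrict U)}
    (hMA : ∀ G, MA G =ᵐ[volume.restrict U] fun x => (A x).toEuclideanLin (G x))
    {H : Euc d → Euc d} (hH : MemLp H 2 (volume.restrict U))
    {K : SobolevH10 U → Lp (Euc d) 2 (volume.restrict U)}
    (hK : ∀ u, K u =ᵐ[volume.restrict U] fun x => sobolevFun u x • H x) {δ : ℝ} (hδ : 0 < δ) :
    ∃ k : ℝ≥0, ∀ t ∈ Set.Icc (0 : ℝ) 1, ∀ u : SobolevH10 U,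
      (u : SobolevH1 U) ∈ testFunctions U → ∀ z : SobolevH10 U, ‖z‖ ≤ 1 →
      (∀ v, inner ℝ (MA (sobolevGrad u) + t • K u) (sobolevGrad v) = inner ℝ z v) →
      volume.restrict U {x | (k : ℝ) ≤ ‖sobolevFun u x‖} ≤ ENNReal.ofReal δ := by
  obtain ⟨C, hC0, hC⟩ := exists_norm_le_norm_sobolevGrad hd hU hUb
  obtain ⟨P, hP0, hP⟩ := exists_norm_sobolevFun_le hd hU hUb
  obtain ⟨k, hk⟩ := exists_measure_superlevel_le (volume.restrict U)
    (P * ((C + ‖hH.toLp H‖) / lam)) hδ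
  refine ⟨k, fun t ht u hu z hz hzv => ?_⟩
  obtain ⟨φ, hφ, rfl⟩ := SobolevH10.exists_eq_toSobolev hU hu
  have hφs := hφ.comp Real.contDiff_arsinh Real.arsinh_zero
  have hφt := hφ.comp Real.contDiff_arctan Real.arctan_zero
  have hw := norm_grad_arsinh_le hlam hA hMA hH hK hC0.le hC ht hφ.contDiff.continuous hz
    (hzv hφt.toSobolev) hφ.sobolevFun_toSobolev hφ.sobolevGrad_toSobolev
    (hφt.sobolevGrad_toSobolev.trans
      (.of_forall fun x => hφ.gradient_comp x (Real.hasDerivAt_arctan' _)))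
    (hφs.sobolevGrad_toSobolev.trans
      (.of_forall fun x => hφ.gradient_comp x (Real.hasDerivAt_arsinh _)))
  refine hk _ (sobolevFun hφs.toSobolev)
    ((hP hφs.toSobolev).trans (mul_le_mul_of_nonneg_left hw hP0)) ?_
  filter_upwards [hφs.sobolevFun_toSobolev, hφ.sobolevFun_toSobolev] with x h1 h2
  rw [h1, h2, Function.comp_apply]

set_option maxHeartbeats 600000 in
/-- The a priori estimate for test functions, uniform along the homotopy `t ∈ [0, 1]` that switches
on the drift. -/
theorem exists_apriori_testFunctions (hd : 3 ≤ d) (hU : IsOpen U) (hUb : Bornology.IsBounded U)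
    {A : Euc d → Matrix (Fin d) (Fin d) ℝ} {M lam : ℝ} (hlam : 0 < lam)
    (hA : IsUniformlyElliptic A M lam)
    {MA : Lp (Euc d) 2 (volume.restrict U) → Lp (Euc d) 2 (volume.restrict U)}
    (hMA : ∀ G, MA G =ᵐ[volume.restrict U] fun x => (A x).toEuclideanLin (G x))
    {H : Euc d → Euc d} (hH : MemLp H (d : ℝ≥0∞) (volume.restrict U))
    {K : SobolevH10 U → Lp (Euc d) 2 (volume.restrict U)}
    (hK : ∀ u, K u =ᵐ[volume.restrict U] fun x => sobolevFun u x • H x) :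
    ∃ C : ℝ, 0 < C ∧ ∀ t ∈ Set.Icc (0 : ℝ) 1, ∀ u : SobolevH10 U,
      (u : SobolevH1 U) ∈ testFunctions U → ∀ z : SobolevH10 U, ‖z‖ ≤ 1 →
      (∀ v, inner ℝ (MA (sobolevGrad u) + t • K u) (sobolevGrad v) = inner ℝ z v) →
      ‖u‖ ≤ C := by
  have : IsFiniteMeasure (volume.restrict U) := ⟨by simpa using hUb.measure_lt_top⟩
  have hH2 : MemLp H 2 (volume.restrict U) :=
    hH.mono_exponent (by exact_mod_cast (by omega : 2 ≤ d))
  obtain ⟨C, hC0, hC⟩ := exists_norm_le_norm_sobolevGrad hd hU hUb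
  obtain ⟨N, hN0, hN⟩ := exists_eLpNorm_sobolevFun_smul_le hd hU hH (ε := lam / 4) (by positivity)
  -- The constant `lam / (4 (N + 1))` makes both drift contributions absorbable by ellipticity.
  obtain ⟨δ, hδ, hδK⟩ := exists_norm_sobolevFun_le_add hd hU hUb
    (η := lam / (4 * (N + 1))) (by positivity)
  obtain ⟨k, hk⟩ := exists_superlevel_le_of_weakSolution hd hU hUb hlam hA hMA hH2 hK hδ
  obtain ⟨L, hL0, hL⟩ := hδK k
  refine ⟨C * (2 / lam * (C + N * L)), by positivity, fun t ht u hu z hz hzv => ?_⟩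
  have hKu : ‖K u‖ ≤ lam / 4 * ‖sobolevGrad u‖ + N * ‖sobolevFun u‖ := by
    rw [Lp.norm_def, eLpNorm_congr_ae (hK u)]
    exact ENNReal.toReal_le_of_le_ofReal (by positivity) (hN u)
  exact (hC u).trans (mul_le_mul_of_nonneg_left (le_of_absorption hlam (norm_nonneg _) hC0.le hN0
    hL0 (hA.energy_le hMA ht (hC u) hz (hzv u)) hKu (hL u (hk t ht u hu z hz hzv))) hC0.le)

end APriori

/-! ### The method of continuity -/

section Continuity

/-- The **method of continuity**: along a segment of bounded operators that are uniformly bounded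
below, invertibility at one end propagates to the other. -/
theorem isUnit_add_of_uniform_bound {V : Type*} [NormedAddCommGroup V] [NormedSpace ℝ V]
    [CompleteSpace V] {S T : V →L[ℝ] V} (hS : IsUnit S) {C : ℝ} (hC : 0 < C)
    (h : ∀ t ∈ Set.Icc (0 : ℝ) 1, ∀ u, ‖u‖ ≤ C * ‖(S + t • T) u‖) : IsUnit (S + T) := by
  rcases subsingleton_or_nontrivial V with hV | hV
  · exact isUnit_of_subsingleton _
  obtain ⟨n, hn⟩ := exists_nat_gt (C * ‖T‖)
  have hn0 : (0 : ℝ) < n := lt_of_le_of_lt (by positivity) hn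
  have key : ∀ k : ℕ, k ≤ n → IsUnit (S + ((k : ℝ) / n) • T) := by
    intro k
    induction k with
    | zero => simpa using hS
    | succ k ih =>
      intro hk
      obtain ⟨x, hx⟩ := ih (by omega)
      have hmem : (k : ℝ) / n ∈ Set.Icc (0 : ℝ) 1 := by
        refine ⟨by positivity, (div_le_one hn0).2 ?_⟩
        exact_mod_cast (by omega : k ≤ n)
      have hinv : ‖(↑x⁻¹ : V →L[ℝ] V)‖ ≤ C := by
        refine ContinuousLinearMap.opNorm_le_bound _ hC.le fun v => ?_
        have h1 := h _ hmem ((↑x⁻¹ : V →L[ℝ] V) v)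
        rwa [← hx, ← mul_apply_eq_comp, Units.mul_inv,
          one_apply_eq_self] at h1
      have hpos : 0 < ‖(↑x⁻¹ : V →L[ℝ] V)‖ := norm_pos_iff.2 (Units.ne_zero _)
      have hdiff : S + (((k + 1 : ℕ) : ℝ) / n) • T - x = (n : ℝ)⁻¹ • T := by
        rw [hx, add_sub_add_left_eq_sub, ← sub_smul]
        congr 1
        push_cast
        field_simp
        ring
      refine (x.ofNearby (S + (((k + 1 : ℕ) : ℝ) / n) • T) ?_).isUnit
      rw [hdiff, norm_smul, norm_inv, Real.norm_of_nonneg hn0.le]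
      calc (n : ℝ)⁻¹ * ‖T‖ < C⁻¹ := by
            rw [inv_mul_lt_iff₀ hn0, ← div_eq_mul_inv, lt_div_iff₀ hC]
            linarith
        _ ≤ _ := inv_anti₀ hpos hinv
  simpa [div_self hn0.ne'] using key n le_rfl

/-- Weak solvability from coercivity of the principal part `a` and an a priori estimate on a dense
subspace that is uniform along the homotopy `a + t K`, `t ∈ [0, 1]`. -/
theorem existsUnique_of_apriori {V E : Type*} [NormedAddCommGroup V] [InnerProductSpace ℝ V]
    [CompleteSpace V] [NormedAddCommGroup E] [InnerProductSpace ℝ E] [CompleteSpace E]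
    (D a K : V →L[ℝ] E) {c : ℝ} (hc : 0 < c) (ha : ∀ u, c * ‖u‖ ^ 2 ≤ inner ℝ (a u) (D u))
    {s : Submodule ℝ V} (hs : Dense (s : Set V)) {C : ℝ} (hC0 : 0 < C)
    (hC : ∀ t ∈ Set.Icc (0 : ℝ) 1, ∀ u ∈ s, ∀ z, ‖z‖ ≤ 1 →
      (∀ v, inner ℝ (a u + t • K u) (D v) = inner ℝ z v) → ‖u‖ ≤ C) (g : StrongDual ℝ V) :
    ∃! u, ∀ v, inner ℝ (a u + K u) (D v) = g v := by
  let S : V →L[ℝ] V := D.adjoint ∘L a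
  let T : V →L[ℝ] V := D.adjoint ∘L K
  have hST : ∀ t u v, inner ℝ ((S + t • T) u) v = inner ℝ (a u + t • K u) (D v) := fun t u v => by
    rw [← ContinuousLinearMap.adjoint_inner_left, map_add, map_smul]
    rfl
  have hS : IsUnit S := by
    refine S.isUnit_of_forall_le_norm_inner_map (c := ⟨c, hc.le⟩) hc fun u => ?_
    have h0 := hST 0 u u
    rw [zero_smul, zero_smul, add_zero, add_zero] at h0
    rw [h0, mul_comm]
    exact (ha u).trans (Real.le_norm_self _)
  have hbound : ∀ t ∈ Set.Icc (0 : ℝ) 1, ∀ u, ‖u‖ ≤ C * ‖(S + t • T) u‖ := fun t ht u => by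
    refine hs.induction (P := fun u => ‖u‖ ≤ C * ‖(S + t • T) u‖) (fun u hu => ?_)
      (isClosed_le continuous_norm (continuous_const.mul (S + t • T).continuous.norm)) u
    rw [← div_le_iff₀' hC0]
    -- Normalize the right-hand side by any `r > ‖(S + t T) u‖`, which covers a vanishing one too.
    refine le_of_forall_gt_imp_ge_of_dense fun r hr => ?_
    have hr0 : 0 < r := (norm_nonneg _).trans_lt hr
    have h := hC t ht (r⁻¹ • u) (s.smul_mem _ hu) ((S + t • T) (r⁻¹ • u)) ?_
      fun v => (hST t _ v).symm
    · rw [norm_smul, norm_inv, Real.norm_of_nonneg hr0.le, inv_mul_le_iff₀ hr0] at h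
      rwa [div_le_iff₀ hC0]
    · rw [map_smul, norm_smul, norm_inv, Real.norm_of_nonneg hr0.le, inv_mul_le_iff₀ hr0, mul_one]
      exact hr.le
  have hbij : Function.Bijective (S + T) :=
    ContinuousLinearMap.isUnit_iff_bijective.1 (isUnit_add_of_uniform_bound hS hC0 hbound)
  -- By the Riesz representation theorem the equation reads `(S + T) u = z`.
  have hiff : ∀ u, (∀ v, inner ℝ (a u + K u) (D v) = g v) ↔
      (S + T) u = (InnerProductSpace.toDual ℝ V).symm g := fun u => by
    rw [ext_iff_inner_right ℝ]
    refine forall_congr' fun v => ?_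
    rw [InnerProductSpace.toDual_symm_apply]
    have h1 := hST 1 u v
    rw [one_smul, one_smul] at h1
    rw [h1]
  simp only [hiff]
  exact hbij.existsUnique _

end Continuity

/-! ### Solvability of the weak equation -/

/-- Coercivity of the principal part on `H₀^{1,2}(U)`. -/
theorem IsUniformlyElliptic.exists_coercive {d : ℕ} {U : Set (Euc d)} (hd : 3 ≤ d) (hU : IsOpen U)
    (hUb : Bornology.IsBounded U) {A : Euc d → Matrix (Fin d) (Fin d) ℝ} {M lam : ℝ}
    (hA : IsUniformlyElliptic A M lam) (hlam : 0 < lam)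
    {MA : Lp (Euc d) 2 (volume.restrict U) → Lp (Euc d) 2 (volume.restrict U)}
    (hMA : ∀ G, MA G =ᵐ[volume.restrict U] fun x => (A x).toEuclideanLin (G x)) :
    ∃ c : ℝ, 0 < c ∧ ∀ u : SobolevH10 U,
      c * ‖u‖ ^ 2 ≤ inner ℝ (MA (sobolevGrad u)) (sobolevGrad u) := by
  obtain ⟨C, hC0, hC⟩ := exists_norm_le_norm_sobolevGrad hd hU hUb
  refine ⟨lam / C ^ 2, by positivity, fun u => ?_⟩
  have h : lam / C ^ 2 * ‖u‖ ^ 2 ≤ lam * ‖sobolevGrad u‖ ^ 2 := by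
    rw [div_mul_eq_mul_div, div_le_iff₀ (by positivity)]
    calc lam * ‖u‖ ^ 2 ≤ lam * (C * ‖sobolevGrad u‖) ^ 2 :=
          mul_le_mul_of_nonneg_left (pow_le_pow_left₀ (norm_nonneg _) (hC u) 2) hlam.le
      _ = _ := by ring
  exact h.trans (hA.mul_norm_sq_le hMA (sobolevGrad u))

/-- `existsUnique_of_apriori` for `H₀^{1,2}(U)`, with `D` the weak gradient and test functions as the
dense subspace. -/
theorem SobolevH10.existsUnique_of_apriori {d : ℕ} {U : Set (Euc d)}
    (MA : Lp (Euc d) 2 (volume.restrict U) →L[ℝ] Lp (Euc d) 2 (volume.restrict U))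
    (K : SobolevH10 U →L[ℝ] Lp (Euc d) 2 (volume.restrict U)) {c C : ℝ} (hc : 0 < c)
    (hcoer : ∀ u : SobolevH10 U, c * ‖u‖ ^ 2 ≤ inner ℝ (MA (sobolevGrad u)) (sobolevGrad u))
    (hC0 : 0 < C)
    (hC : ∀ t ∈ Set.Icc (0 : ℝ) 1, ∀ u : SobolevH10 U,
      (u : SobolevH1 U) ∈ testFunctions U → ∀ z : SobolevH10 U, ‖z‖ ≤ 1 →
      (∀ v, inner ℝ (MA (sobolevGrad u) + t • K u) (sobolevGrad v) = inner ℝ z v) → ‖u‖ ≤ C)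
    (g : SobolevHneg1 U) :
    ∃! u : SobolevH10 U, ∀ v,
      inner ℝ (MA (sobolevGrad u) + K u) (sobolevGrad v) = g v := by
  have h1 := _root_.existsUnique_of_apriori (V := SobolevH10 U)
    (E := Lp (Euc d) 2 (volume.restrict U)) (sobolevGradL U)
  have h2 := h1 (MA ∘L sobolevGradL U) K hc hcoer
    (s := (testFunctions U).comap (SobolevH10 U).subtype) SobolevH10.dense_testFunctions hC0 hC
  exact h2 g

section Form

variable {d : ℕ} {U : Set (Euc d)} {A : Euc d → Matrix (Fin d) (Fin d) ℝ} {H : Euc d → Euc d}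
  {MA : Lp (Euc d) 2 (volume.restrict U) → Lp (Euc d) 2 (volume.restrict U)}
  {K : SobolevH10 U → Lp (Euc d) 2 (volume.restrict U)}

theorem formIntegrand_ae_eq
    (hMA : ∀ G, MA G =ᵐ[volume.restrict U] fun x => (A x).toEuclideanLin (G x))
    (hK : ∀ u, K u =ᵐ[volume.restrict U] fun x => sobolevFun u x • H x) (f φ : SobolevH10 U) :
    formIntegrand A H f φ =ᵐ[volume.restrict U]
      fun x => inner ℝ ((MA (sobolevGrad f) + K f) x) (sobolevGrad φ x) := by
  filter_upwards [hMA (sobolevGrad f), hK f, Lp.coeFn_add (MA (sobolevGrad f)) (K f)]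
    with x h1 h2 h3
  rw [h3, Pi.add_apply, h1, h2]
  rfl

theorem integrableOn_formIntegrand
    (hMA : ∀ G, MA G =ᵐ[volume.restrict U] fun x => (A x).toEuclideanLin (G x))
    (hK : ∀ u, K u =ᵐ[volume.restrict U] fun x => sobolevFun u x • H x) (f φ : SobolevH10 U) :
    IntegrableOn (formIntegrand A H f φ) U volume :=
  (L2.integrable_inner (𝕜 := ℝ) (MA (sobolevGrad f) + K f) (sobolevGrad φ)).congr
    (formIntegrand_ae_eq hMA hK f φ).symm

theorem dirichletForm_eq_inner
    (hMA : ∀ G, MA G =ᵐ[volume.restrict U] fun x => (A x).toEuclideanLin (G x))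
    (hK : ∀ u, K u =ᵐ[volume.restrict U] fun x => sobolevFun u x • H x) (f φ : SobolevH10 U) :
    dirichletForm A H f φ = inner ℝ (MA (sobolevGrad f) + K f) (sobolevGrad φ) := by
  rw [L2.inner_def]
  exact integral_congr_ae (formIntegrand_ae_eq hMA hK f φ)

end Form

set_option maxHeartbeats 400000 in
theorem corollary3p6 {d : ℕ} (hd : 3 ≤ d) (U : Set (Euc d)) (hU : IsOpen U)
    (hUb : Bornology.IsBounded U) (H : Euc d → Euc d)
    (hH : MemLp H (d : ℝ≥0∞) (volume.restrict U))
    (A : Euc d → Matrix (Fin d) (Fin d) ℝ) (M lam : ℝ) (hM : 0 < M) (hlam : 0 < lam)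
    (hA : IsUniformlyElliptic A M lam) :
    (∀ f φ : SobolevH10 U, IntegrableOn (formIntegrand A H f φ) U volume) ∧
    ∀ g : SobolevHneg1 U, ∃! u : SobolevH10 U,
      ∀ φ : SobolevH10 U, dirichletForm A H u φ = g φ := by
  obtain ⟨MA, hMA⟩ := hA.exists_matrixMul (U := U)
  obtain ⟨K, hK⟩ := exists_driftMul hd hU hH
  refine ⟨integrableOn_formIntegrand hMA hK, fun g => ?_⟩
  obtain ⟨c, hc, hcoer⟩ := hA.exists_coercive hd hU hUb hlam hMA
  obtain ⟨C, hC0, hC⟩ := exists_apriori_testFunctions hd hU hUb hlam hA hMA hH hK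
  simp only [dirichletForm_eq_inner hMA hK]
  exact SobolevH10.existsUnique_of_apriori MA K hc hcoer hC0 hC g
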